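/- A preordered set $(\Lambda,\lesssim)$ is called $\mathbb{Z}$-like if every finite subset of $\Lambda$ is contained in a finite subset $S$ that is strongly convex: every $i\in\Lambda\setminus S$ lies strictly below all elements of $S$ or strictly above all elements of $S$. (Here $i$ is strictly below $j$ if $i\lesssim j$ and $j\not\lesssim i$.) A subset $S$ is convex if $i,j\in S$ and $i\lesssim k\lesssim j$ imply $k\in S$. Let $\Lambda$ be an infinite $\mathbb{Z}$-like preordered set and $F$ a field, regarded as a discrete topological field. Let $\mathrm{AU}_\Lambda(F)$ be the group, under matrix multiplication, of all $\Lambda\times\Lambda$-matrices $(a_{ij})$ over $F$ that are * almost upper triangular: $a_{ij}=0$ for all but finitely many pairs $(i,j)$ with $i\not\lesssim j$; and * nonsingular: there is a finite convex $S\subset\Lambda$ such that $(a_{ij})_{i,j\in T}$ is invertible for every finite convex $T\supseteq S$. For finite convex $S\subset\Lambda$ let $\mathrm{U}_{\Lambda+S}(F)$ be the set of those elements of $\mathrm{AU}_\Lambda(F)$ that are upper triangular for the preorder generated by $\lesssim$ and $S\times S$, with the topology of entrywise convergence. Then $\mathrm{AU}_\Lambda(F)=\bigcup_S\mathrm{U}_{\Lambda+S}(F)$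 carries the direct limit topology, i.e. a subset is open if and only if its intersection with each $\mathrm{U}_{\Lambda+S}(F)$ is open in $\mathrm{U}_{\Lambda+S}(F)$. Let $\mathrm{Z}_\Lambda(F)$ be the normal subgroup of nonsingular scalar matrices. Put $$\mathrm{L}(F)=\{(x_j)\in F^\Lambda \mid \text{there is } k\in\Lambda \text{ with } x_l=0 \text{ for all } l \text{ with } k\lesssim l\}$$ and $$\mathcal{AU}_\Lambda(F)=\Bigl\{I+B\in\mathrm{AU}_\Lambda(F) \Bigm| \text{the map } (x_j)\mapsto \bigl(\textstyle\sum_{j} b_{ij}x_j\bigr)_i \text{ on } \mathrm{L}(F) \text{ has finite rank}\Bigr\},$$ where finite rank means that the image of $\mathrm{L}(F)$ spans a finite-dimensional subspace of $F^\Lambda$. Then $\mathcal{AU}_\Lambda(F)$ is a subgroup of $\mathrm{AU}_\Lambda(F)$; it is proper, dense and normal. In particular, $\mathrm{AU}_\Lambda(F)/\mathrm{Z}_\Lambda(F)$ is a nontrivial group that is not simple as an abstract group. -/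

import Mathlib

namespace AlmostUpperTriangular

section Preorders

variable {Λ : Type*} [Preorder Λ]

/-- `S` is strongly convex: every element outside `S` lies strictly below all of `S` or strictly
above all of `S` (in a preorder, `i < j` means `i ≤ j` and not `j ≤ i`). -/
def StronglyConvex (S : Set Λ) : Prop :=
  ∀ i, i ∉ S → (∀ j ∈ S, i < j) ∨ (∀ j ∈ S, j < i)

/-- A preordered set is `ℤ`-like if every finite subset is contained in a finite strongly convex
subset. -/
class ZLike (Λ : Type*) [Preorder Λ] : Prop where
  exists_finite_stronglyConvex :
    ∀ A : Finset Λ, ∃ S : Finset Λ, A ⊆ S ∧ StronglyConvex (S : Set Λ)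

/-- The preorder of `Λ + S`: the one generated by `≤` together with declaring all elements of `S`
equivalent. -/
def JoinLE (S : Finset Λ) : Λ → Λ → Prop :=
  Relation.ReflTransGen fun i j => i ≤ j ∨ (i ∈ S ∧ j ∈ S)

end Preorders

section Matrices

open scoped Classical

variable {Λ : Type*} {F : Type*} [Field F]

/-- The finite submatrix of `a` with rows and columns in `T`. -/
def res (T : Finset Λ) (a : Matrix Λ Λ F) : Matrix T T F :=
  a.submatrix Subtype.val Subtype.val

/-- The product of infinite matrices (the sums are finite for almost upper triangular matrices). -/
noncomputable def mulMat (a b : Matrix Λ Λ F) : Matrix Λ Λ F :=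
  fun i j => ∑ᶠ k, a i k * b k j

/-- The column vector `a x` (the sums are finite where it is used). -/
noncomputable def act (a : Matrix Λ Λ F) (x : Λ → F) : Λ → F :=
  fun i => ∑ᶠ j, a i j * x j

/-- `a` is a scalar matrix. -/
def IsScalar (a : Matrix Λ Λ F) : Prop :=
  (∀ i j, i ≠ j → a i j = 0) ∧ ∀ i j, a i i = a j j

theorem res_one (T : Finset Λ) : res T (1 : Matrix Λ Λ F) = 1 :=
  Matrix.submatrix_one _ Subtype.val_injective

theorem mulMat_one (a : Matrix Λ Λ F) : mulMat a 1 = a := by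
  ext i j
  change ∑ᶠ k, a i k * (1 : Matrix Λ Λ F) k j = a i j
  rw [finsum_eq_single _ j fun k hk => by rw [Matrix.one_apply_ne hk, mul_zero]]
  simp

theorem one_mulMat (a : Matrix Λ Λ F) : mulMat 1 a = a := by
  ext i j
  change ∑ᶠ k, (1 : Matrix Λ Λ F) i k * a k j = a i j
  rw [finsum_eq_single _ i fun k hk => by rw [Matrix.one_apply_ne hk.symm, zero_mul]]
  simp

theorem IsScalar.mulMat_apply {a : Matrix Λ Λ F} (ha : IsScalar a) (b : Matrix Λ Λ F) (i j : Λ) :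
    mulMat a b i j = a i i * b i j :=
  finsum_eq_single _ i fun k hk => by rw [ha.1 i k hk.symm, zero_mul]

theorem IsScalar.mulMat_apply_right {a : Matrix Λ Λ F} (ha : IsScalar a) (b : Matrix Λ Λ F)
    (i j : Λ) : mulMat b a i j = b i j * a j j :=
  finsum_eq_single _ j fun k hk => by rw [ha.1 k j hk, mul_zero]

variable [Preorder Λ]

/-- `a` has only finitely many nonzero entries at positions `(i, j)` with `¬ i ≤ j`. -/
def AlmostUpper (a : Matrix Λ Λ F) : Prop :=
  {p : Λ × Λ | ¬ p.1 ≤ p.2 ∧ a p.1 p.2 ≠ 0}.Finite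

/-- `a` is nonsingular: for some finite convex `S`, the `T × T`-submatrix of `a` is invertible for
every finite convex `T ⊇ S`. -/
def Nonsingular (a : Matrix Λ Λ F) : Prop :=
  ∃ S : Finset Λ, (S : Set Λ).OrdConnected ∧
    ∀ T : Finset Λ, (T : Set Λ).OrdConnected → S ⊆ T → IsUnit (res T a)

variable (Λ F) in
/-- The underlying set of `AU_Λ(F)`: nonsingular almost upper triangular matrices. -/
@[ext] structure AU where
  toMatrix : Matrix Λ Λ F
  almostUpper : AlmostUpper toMatrix
  nonsingular : Nonsingular toMatrix

/-! ### `AU_Λ(F)` is a group -/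

/-- `a` vanishes at `(i, j)` unless `i ≤ j` or both `i` and `j` lie in `S`. -/
def Adapted (S : Finset Λ) (a : Matrix Λ Λ F) : Prop :=
  ∀ i j, a i j ≠ 0 → i ≤ j ∨ (i ∈ S ∧ j ∈ S)

theorem StronglyConvex.ordConnected {S : Set Λ} (h : StronglyConvex S) : S.OrdConnected := by
  refine ⟨fun i hi j hj k hk => ?_⟩
  by_contra hkS
  rcases h k hkS with h1 | h1
  · exact (h1 i hi).not_ge hk.1
  · exact (h1 j hj).not_ge hk.2

theorem Adapted.mono {S T : Finset Λ} {a : Matrix Λ Λ F} (h : Adapted S a) (hST : S ⊆ T) :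
    Adapted T a := fun i j hij => (h i j hij).imp id fun h => ⟨hST h.1, hST h.2⟩

theorem Adapted.almostUpper {S : Finset Λ} {a : Matrix Λ Λ F} (h : Adapted S a) :
    AlmostUpper a := by
  refine (S ×ˢ S).finite_toSet.subset ?_
  rintro ⟨i, j⟩ ⟨h1, h2⟩
  have := (h i j h2).resolve_left h1
  simpa using this

theorem AlmostUpper.exists_finset {a : Matrix Λ Λ F} (h : AlmostUpper a) :
    ∃ A : Finset Λ, Adapted A a := by
  refine ⟨h.toFinset.image Prod.fst ∪ h.toFinset.image Prod.snd, fun i j hij => ?_⟩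
  by_cases hle : i ≤ j
  · exact Or.inl hle
  · have hm : (i, j) ∈ h.toFinset := h.mem_toFinset.2 ⟨hle, hij⟩
    exact Or.inr ⟨Finset.mem_union_left _ (Finset.mem_image_of_mem Prod.fst hm),
      Finset.mem_union_right _ (Finset.mem_image_of_mem Prod.snd hm)⟩

/-- Transitivity of the relation `i ≤ j ∨ i, j ∈ S` for strongly convex `S`. -/
theorem StronglyConvex.trans {S : Finset Λ} (hS : StronglyConvex (S : Set Λ)) {i k j : Λ}
    (h1 : i ≤ k ∨ (i ∈ S ∧ k ∈ S)) (h2 : k ≤ j ∨ (k ∈ S ∧ j ∈ S)) :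
    i ≤ j ∨ (i ∈ S ∧ j ∈ S) := by
  rcases h1 with h1 | ⟨hi, hk⟩ <;> rcases h2 with h2 | ⟨hk', hj⟩
  · exact Or.inl (h1.trans h2)
  · by_cases hi : i ∈ S
    · exact Or.inr ⟨hi, hj⟩
    · rcases hS i hi with h | h
      · exact Or.inl (h j hj).le
      · exact absurd h1 (h k hk').not_ge
  · by_cases hj : j ∈ S
    · exact Or.inr ⟨hi, hj⟩
    · rcases hS j hj with h | h
      · exact absurd h2 (h k hk).not_ge
      · exact Or.inl (h i hi).le
  · exact Or.inr ⟨hi, hj⟩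

theorem mem_of_between {S T : Finset Λ} (hT : (T : Set Λ).OrdConnected) (hST : S ⊆ T)
    {i k j : Λ} (hi : i ∈ T) (hj : j ∈ T)
    (h1 : i ≤ k ∨ (i ∈ S ∧ k ∈ S)) (h2 : k ≤ j ∨ (k ∈ S ∧ j ∈ S)) : k ∈ T := by
  rcases h1 with h1 | ⟨_, hk⟩
  · rcases h2 with h2 | ⟨hk, _⟩
    · exact hT.out hi hj ⟨h1, h2⟩
    · exact hST hk
  · exact hST hk

theorem mulMat_apply_eq {S T : Finset Λ} {a b : Matrix Λ Λ F} (ha : Adapted S a)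
    (hb : Adapted S b) (hT : (T : Set Λ).OrdConnected) (hST : S ⊆ T) {i j : Λ}
    (hi : i ∈ T) (hj : j ∈ T) : mulMat a b i j = ∑ k ∈ T, a i k * b k j := by
  refine finsum_eq_sum_of_support_subset _ fun k hk => ?_
  have hk' : a i k * b k j ≠ 0 := hk
  exact mem_of_between hT hST hi hj (ha i k (left_ne_zero_of_mul hk'))
    (hb k j (right_ne_zero_of_mul hk'))

theorem res_mulMat {S T : Finset Λ} {a b : Matrix Λ Λ F} (ha : Adapted S a)
    (hb : Adapted S b) (hT : (T : Set Λ).OrdConnected) (hST : S ⊆ T) :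
    res T (mulMat a b) = res T a * res T b := by
  ext i j
  rw [Matrix.mul_apply]
  change mulMat a b i j = ∑ k : T, a i k * b k j
  rw [mulMat_apply_eq ha hb hT hST i.2 j.2, ← Finset.sum_coe_sort]

theorem Adapted.mul {S : Finset Λ} {a b : Matrix Λ Λ F} (hS : StronglyConvex (S : Set Λ))
    (ha : Adapted S a) (hb : Adapted S b) : Adapted S (mulMat a b) := by
  intro i j hij
  obtain ⟨k, hk⟩ : ∃ k, a i k * b k j ≠ 0 := by
    by_contra! h
    exact hij (finsum_eq_zero_of_forall_eq_zero h)
  exact hS.trans (ha i k (left_ne_zero_of_mul hk)) (hb k j (right_ne_zero_of_mul hk))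

theorem adapted_one (S : Finset Λ) : Adapted S (1 : Matrix Λ Λ F) := by
  intro i j hij
  by_cases h : i = j
  · exact Or.inl h.le
  · exact absurd (Matrix.one_apply_ne h) hij

theorem nonsingular_one : Nonsingular (1 : Matrix Λ Λ F) :=
  ⟨∅, by simpa using Set.ordConnected_empty, fun T _ _ => by rw [res_one]; exact isUnit_one⟩

/-- If an invertible finite matrix vanishes outside the relation `i ≤ j ∨ i, j ∈ S`, so does its
inverse. -/
theorem inv_adapted {S T : Finset Λ} (hS : StronglyConvex (S : Set Λ)) {M : Matrix T T F}
    (hM : IsUnit M)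
    (hMS : ∀ i j : T, M i j ≠ 0 → i.1 ≤ j.1 ∨ (i.1 ∈ S ∧ j.1 ∈ S)) (i j : T)
    (hij : M⁻¹ i j ≠ 0) : i.1 ≤ j.1 ∨ (i.1 ∈ S ∧ j.1 ∈ S) := by
  let A : Submodule F (Matrix T T F) :=
    { carrier := {N | ∀ i j : T, ¬ (i.1 ≤ j.1 ∨ (i.1 ∈ S ∧ j.1 ∈ S)) → N i j = 0}
      add_mem' := fun {x y} hx hy i j h => by simp [hx i j h, hy i j h]
      zero_mem' := fun i j _ => rfl
      smul_mem' := fun c x hx i j h => by simp [hx i j h] }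
  have hmul : ∀ N ∈ A, M * N ∈ A := by
    intro N hN i j h
    rw [Matrix.mul_apply]
    refine Finset.sum_eq_zero fun k _ => ?_
    by_contra hk
    refine h (hS.trans (hMS i k (left_ne_zero_of_mul hk)) ?_)
    by_contra h'
    exact right_ne_zero_of_mul hk (hN k j h')
  let L : A →ₗ[F] A := (LinearMap.mulLeft F M).restrict hmul
  have hinj : Function.Injective L := by
    intro x y hxy
    have h : M * x.1 = M * y.1 := congrArg Subtype.val hxy
    exact Subtype.ext (hM.mul_left_cancel h)
  have h1 : (1 : Matrix T T F) ∈ A := fun i j h =>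
    Matrix.one_apply_ne fun hij => h (Or.inl (by rw [hij]))
  obtain ⟨N, hN⟩ := LinearMap.injective_iff_surjective.1 hinj ⟨1, h1⟩
  have hMN : M * N.1 = 1 := congrArg Subtype.val hN
  by_contra h
  rw [Matrix.inv_eq_right_inv hMN] at hij
  exact hij (N.2 i j h)

/-- Inverses of finite submatrices are compatible with restriction. -/
theorem exists_local_inv {S T : Finset Λ} {a : Matrix Λ Λ F} (hS : StronglyConvex (S : Set Λ))
    (ha : Adapted S a) (hT : (T : Set Λ).OrdConnected) (hST : S ⊆ T) (hu : IsUnit (res T a)) :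
    ∃ e : Matrix Λ Λ F, Adapted S e ∧ ∀ U : Finset Λ, (U : Set Λ).OrdConnected → S ⊆ U → U ⊆ T →
      res U a * res U e = 1 := by
  let e : Matrix Λ Λ F := fun i j =>
    if h : i ∈ T ∧ j ∈ T then (res T a)⁻¹ ⟨i, h.1⟩ ⟨j, h.2⟩ else 0
  have heT : res T e = (res T a)⁻¹ := by
    ext i j
    exact dif_pos ⟨i.2, j.2⟩
  have he : Adapted S e := by
    intro i j hij
    by_cases h : i ∈ T ∧ j ∈ T
    · have h0 : e i j = (res T a)⁻¹ ⟨i, h.1⟩ ⟨j, h.2⟩ := dif_pos h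
      rw [h0] at hij
      exact inv_adapted hS hu (fun i j h => ha i j h) _ _ hij
    · exact absurd (dif_neg h) hij
  refine ⟨e, he, fun U hU hSU hUT => ?_⟩
  have h1 : res T (mulMat a e) = 1 := by
    rw [res_mulMat ha he hT hST, heT]
    exact Matrix.mul_nonsing_inv _ ((Matrix.isUnit_iff_isUnit_det _).1 hu)
  rw [← res_mulMat ha he hU hSU, ← res_one (F := F) U]
  ext i j
  have h2 := congrFun (congrFun (h1.trans (res_one (F := F) T).symm) ⟨i, hUT i.2⟩) ⟨j, hUT j.2⟩
  exact h2

namespace AU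

noncomputable instance : One (AU Λ F) :=
  ⟨⟨1, (adapted_one ∅).almostUpper, nonsingular_one⟩⟩

theorem toMatrix_one : (1 : AU Λ F).toMatrix = 1 := rfl

end AU

variable [ZLike Λ]

theorem exists_adapted (A : Finset Λ) {a : Matrix Λ Λ F} (ha : AlmostUpper a) :
    ∃ S : Finset Λ, A ⊆ S ∧ StronglyConvex (S : Set Λ) ∧ Adapted S a := by
  obtain ⟨B, hB⟩ := ha.exists_finset
  obtain ⟨S, h1, h2⟩ := ZLike.exists_finite_stronglyConvex (A ∪ B)
  exact ⟨S, Finset.union_subset_left h1, h2, hB.mono (Finset.union_subset_right h1)⟩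

theorem exists_adapted₂ (A : Finset Λ) {a b : Matrix Λ Λ F} (ha : AlmostUpper a)
    (hb : AlmostUpper b) :
    ∃ S : Finset Λ, A ⊆ S ∧ StronglyConvex (S : Set Λ) ∧ Adapted S a ∧ Adapted S b := by
  obtain ⟨B, hB⟩ := ha.exists_finset
  obtain ⟨S, h1, h2, h3⟩ := exists_adapted (A ∪ B) hb
  exact ⟨S, Finset.union_subset_left h1, h2, hB.mono (Finset.union_subset_right h1), h3⟩

theorem AlmostUpper.mul {a b : Matrix Λ Λ F} (ha : AlmostUpper a) (hb : AlmostUpper b) :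
    AlmostUpper (mulMat a b) := by
  obtain ⟨S, -, hS, h1, h2⟩ := exists_adapted₂ ∅ ha hb
  exact (h1.mul hS h2).almostUpper

theorem Nonsingular.mul {a b : Matrix Λ Λ F} (ha : AlmostUpper a) (hb : AlmostUpper b)
    (ha' : Nonsingular a) (hb' : Nonsingular b) : Nonsingular (mulMat a b) := by
  obtain ⟨A, -, hA⟩ := ha'
  obtain ⟨B, -, hB⟩ := hb'
  obtain ⟨S, hS0, hS, h1, h2⟩ := exists_adapted₂ (A ∪ B) ha hb
  refine ⟨S, hS.ordConnected, fun T hT hST => ?_⟩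
  rw [res_mulMat h1 h2 hT hST]
  exact (hA T hT ((Finset.union_subset_left hS0).trans hST)).mul
    (hB T hT ((Finset.union_subset_right hS0).trans hST))

theorem mulMat_assoc {a b c : Matrix Λ Λ F} (ha : AlmostUpper a) (hb : AlmostUpper b)
    (hc : AlmostUpper c) : mulMat (mulMat a b) c = mulMat a (mulMat b c) := by
  ext i j
  obtain ⟨A, hA⟩ := ha.exists_finset
  obtain ⟨S, hS0, hS, h2, h3⟩ := exists_adapted₂ ({i, j} ∪ A) hb hc
  have h1 := hA.mono (Finset.union_subset_right hS0)
  have hi : i ∈ S := hS0 (by simp)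
  have hj : j ∈ S := hS0 (by simp)
  have hres : res S (mulMat (mulMat a b) c) = res S (mulMat a (mulMat b c)) := by
    rw [res_mulMat (h1.mul hS h2) h3 hS.ordConnected le_rfl,
      res_mulMat h1 (h2.mul hS h3) hS.ordConnected le_rfl,
      res_mulMat h1 h2 hS.ordConnected le_rfl, res_mulMat h2 h3 hS.ordConnected le_rfl,
      mul_assoc]
  exact congrFun (congrFun hres ⟨i, hi⟩) ⟨j, hj⟩

/-- A nonsingular almost upper triangular matrix has an inverse of the same kind. -/
theorem exists_inverse {a : Matrix Λ Λ F} (ha : AlmostUpper a) (ha' : Nonsingular a) :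
    ∃ b : Matrix Λ Λ F, AlmostUpper b ∧ Nonsingular b ∧ mulMat b a = 1 := by
  obtain ⟨S₀, -, hu₀⟩ := ha'
  obtain ⟨S, hS₀, hS, haS⟩ := exists_adapted S₀ ha
  have hu : ∀ T : Finset Λ, (T : Set Λ).OrdConnected → S ⊆ T → IsUnit (res T a) :=
    fun T hT h => hu₀ T hT (hS₀.trans h)
  have hE : ∀ T : Finset Λ, (T : Set Λ).OrdConnected → S ⊆ T →
      ∃ e : Matrix Λ Λ F, Adapted S e ∧
        ∀ U : Finset Λ, (U : Set Λ).OrdConnected → S ⊆ U → U ⊆ T → res U a * res U e = 1 :=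
    fun T hT h => exists_local_inv hS haS hT h (hu T hT h)
  choose! e heS he using hE
  have hT : ∀ i j : Λ, ∃ T : Finset Λ, S ∪ {i, j} ⊆ T ∧ StronglyConvex (T : Set Λ) :=
    fun i j => ZLike.exists_finite_stronglyConvex _
  choose T hT₁ hT₂ using hT
  have hST : ∀ i j, S ⊆ T i j := fun i j => Finset.union_subset_left (hT₁ i j)
  have hiT : ∀ i j, i ∈ T i j := fun i j => hT₁ i j (by simp)
  have hjT : ∀ i j, j ∈ T i j := fun i j => hT₁ i j (by simp)
  let b : Matrix Λ Λ F := fun i j => e (T i j) i j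
  have hb : Adapted S b := fun i j hij => heS _ (hT₂ i j).ordConnected (hST i j) i j hij
  have hbU : ∀ U : Finset Λ, (U : Set Λ).OrdConnected → S ⊆ U → res U b * res U a = 1 := by
    intro U hU hSU
    have key : res U b = (res U a)⁻¹ := by
      ext i j
      obtain ⟨V, hV₁, hV₂⟩ := ZLike.exists_finite_stronglyConvex (U ∪ T i j)
      have hUV := Finset.union_subset_left hV₁
      have hTV := Finset.union_subset_right hV₁
      have hSV := hSU.trans hUV
      have e1 := Matrix.inv_eq_right_inv
        (he V hV₂.ordConnected hSV U hU hSU hUV)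
      have e2 := Matrix.inv_eq_right_inv
        (he V hV₂.ordConnected hSV (T i j) (hT₂ i j).ordConnected (hST i j) hTV)
      have e3 := Matrix.inv_eq_right_inv
        (he (T i j) (hT₂ i j).ordConnected (hST i j) (T i j) (hT₂ i j).ordConnected (hST i j)
          le_rfl)
      rw [e1]
      exact congrFun (congrFun (e3.symm.trans e2) ⟨i, hiT i j⟩) ⟨j, hjT i j⟩
    rw [key]
    exact Matrix.nonsing_inv_mul _ ((Matrix.isUnit_iff_isUnit_det _).1 (hu U hU hSU))
  refine ⟨b, hb.almostUpper, ⟨S, hS.ordConnected, fun U hU hSU => ?_⟩, ?_⟩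
  · exact IsUnit.of_mul_eq_one _ (hbU U hU hSU)
  · ext i j
    have h1 : res (T i j) (mulMat b a) = res (T i j) 1 := by
      rw [res_mulMat hb haS (hT₂ i j).ordConnected (hST i j),
        hbU _ (hT₂ i j).ordConnected (hST i j), res_one]
    exact congrFun (congrFun h1 ⟨i, hiT i j⟩) ⟨j, hjT i j⟩

namespace AU

noncomputable instance : Mul (AU Λ F) :=
  ⟨fun a b => ⟨mulMat a.toMatrix b.toMatrix, a.almostUpper.mul b.almostUpper,
    a.nonsingular.mul a.almostUpper b.almostUpper b.nonsingular⟩⟩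

noncomputable instance : Inv (AU Λ F) :=
  ⟨fun a =>
    ⟨(exists_inverse a.almostUpper a.nonsingular).choose,
      (exists_inverse a.almostUpper a.nonsingular).choose_spec.1,
      (exists_inverse a.almostUpper a.nonsingular).choose_spec.2.1⟩⟩

theorem toMatrix_mul (a b : AU Λ F) : (a * b).toMatrix = mulMat a.toMatrix b.toMatrix := rfl

/-- `AU_Λ(F)` is a group under matrix multiplication. -/
noncomputable instance : Group (AU Λ F) :=
  Group.ofLeftAxioms
    (fun a b c => AU.ext (mulMat_assoc a.almostUpper b.almostUpper c.almostUpper))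
    (fun a => AU.ext (one_mulMat a.toMatrix))
    (fun a => AU.ext (exists_inverse a.almostUpper a.nonsingular).choose_spec.2.2)

end AU

theorem IsScalar.commute {z : AU Λ F} (hz : IsScalar z.toMatrix) (g : AU Λ F) :
    z * g = g * z := by
  refine AU.ext ?_
  ext i j
  rw [AU.toMatrix_mul, AU.toMatrix_mul, hz.mulMat_apply, hz.mulMat_apply_right, hz.2 i j, mul_comm]

variable (Λ F) in
/-- `Z_Λ(F)`: the subgroup of nonsingular scalar matrices. -/
noncomputable def scalarSubgroup : Subgroup (AU Λ F) where
  carrier := {z | IsScalar z.toMatrix}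
  one_mem' := ⟨fun i j h => Matrix.one_apply_ne h, fun i j => by
    rw [AU.toMatrix_one, Matrix.one_apply_eq, Matrix.one_apply_eq]⟩
  mul_mem' := fun {x y} hx hy => by
    refine ⟨fun i j h => ?_, fun i j => ?_⟩
    · rw [AU.toMatrix_mul, IsScalar.mulMat_apply hx, hy.1 i j h, mul_zero]
    · rw [AU.toMatrix_mul, IsScalar.mulMat_apply hx, IsScalar.mulMat_apply hx, hx.2 i j, hy.2 i j]
  inv_mem' := fun {x} hx => by
    have h : ∀ i j, x.toMatrix i i * (x⁻¹).toMatrix i j = (1 : Matrix Λ Λ F) i j := fun i j => by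
      rw [← IsScalar.mulMat_apply hx, ← AU.toMatrix_mul, mul_inv_cancel, AU.toMatrix_one]
    have h0 : ∀ i, x.toMatrix i i ≠ 0 := fun i h' => by
      have := h i i
      rw [h', zero_mul, Matrix.one_apply_eq] at this
      exact zero_ne_one this
    refine ⟨fun i j hij => ?_, fun i j => ?_⟩
    · have := h i j
      rw [Matrix.one_apply_ne hij] at this
      exact (mul_eq_zero.1 this).resolve_left (h0 i)
    · refine mul_left_cancel₀ (h0 i) ?_
      rw [h i i, hx.2 i j, h j j, Matrix.one_apply_eq, Matrix.one_apply_eq]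

instance : (scalarSubgroup Λ F).Normal :=
  ⟨fun z hz g => by
    rw [← IsScalar.commute hz g, mul_assoc, mul_inv_cancel, mul_one]
    exact hz⟩

/-! ### The topology of `AU_Λ(F)` -/

variable (Λ F) in
/-- `U_{Λ+S}(F)`: the elements of `AU_Λ(F)` that are upper triangular for the preorder of
`Λ + S`. -/
def UJoin (S : Finset Λ) : Set (AU Λ F) :=
  {a | ∀ i j, ¬ JoinLE S i j → a.toMatrix i j = 0}

variable (Λ F) in
/-- The topology of entrywise convergence on `U_{Λ+S}(F)`, the field `F` being discrete. -/
abbrev entrywiseTopology (S : Finset Λ) : TopologicalSpace (UJoin Λ F S) :=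
  TopologicalSpace.induced (fun a (p : Λ × Λ) => a.1.toMatrix p.1 p.2)
    (@Pi.topologicalSpace (Λ × Λ) (fun _ => F) fun _ => ⊥)

/-- The direct limit topology on `AU_Λ(F) = ⋃ U_{Λ+S}(F)`, over all finite convex `S`: a subset of
`AU_Λ(F)` is open exactly when its trace on every `U_{Λ+S}(F)` is open for entrywise convergence.
As `U_{Λ+S}(F) ∩ U_{Λ+S'}(F)` is open in both and has the same topology from either, this is the
topology for which all inclusions `U_{Λ+S}(F) → AU_Λ(F)` are open embeddings. -/
instance : TopologicalSpace (AU Λ F) :=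
  ⨆ S : {S : Finset Λ // (S : Set Λ).OrdConnected},
    TopologicalSpace.coinduced Subtype.val (entrywiseTopology Λ F S.1)

/-! ### The subgroup of finite-rank perturbations of the identity -/

variable (Λ F) in
/-- `L(F)`: the vectors `x` for which there is `k` with `x l = 0` for all `l ≥ k`. -/
def vecL : Set (Λ → F) :=
  {x | ∃ k : Λ, ∀ l, k ≤ l → x l = 0}

/-- The map `x ↦ b x` on `L(F)` has finite rank: its image spans a finite-dimensional subspace. -/
def HasFiniteRank (b : Matrix Λ Λ F) : Prop :=
  FiniteDimensional F (Submodule.span F (act b '' vecL Λ F))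

variable (Λ F) in
/-- The set of all `1 + b` in `AU_Λ(F)` such that `b` acts with finite rank on `L(F)`. -/
def finiteRankAU : Set (AU Λ F) :=
  {g | ∃ b : Matrix Λ Λ F, g.toMatrix = 1 + b ∧ HasFiniteRank b}

end Matrices
end AlmostUpperTriangular

/-! `AU_Λ(F)` acts linearly on the space of vectors vanishing strictly above some finite set. The
span of `L(F)` has finite codimension in this space, so `b` has finite rank on `L(F)` exactly when
it has finite rank on the whole space. Endomorphisms of finite rank form a two-sided ideal, and
the matrices `1 + b` in question are the kernel of the action modulo this ideal, hence a normal
subgroup. It is dense because a neighbourhood only controls finitely many entries: truncating `g`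
to a large finite square, with the identity matrix elsewhere, yields an element of the subgroup.
It contains nonscalar transvections, but even together with the scalars it is not the whole group:
for infinitely many disjoint pairs `r n < s n`, the matrix `1 + ∑ₙ E_{r n, s n}` differs from
every scalar matrix by an endomorphism of infinite rank. -/

namespace AlmostUpperTriangular

section GroupTheory

theorem not_isSimpleGroup_quotient_of_sup_ne_top {G : Type*} [Group G] {N Z : Subgroup G}
    [hN : N.Normal] [Z.Normal] (hNZ : ¬ N ≤ Z) (hsup : N ⊔ Z ≠ ⊤) : ¬ IsSimpleGroup (G ⧸ Z) := by
  intro hsimple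
  have hnormal : (N.map (QuotientGroup.mk' Z)).Normal :=
    hN.map _ (QuotientGroup.mk'_surjective Z)
  rcases hsimple.eq_bot_or_eq_top_of_normal _ hnormal with hbot | htop
  · rw [Subgroup.map_eq_bot_iff, QuotientGroup.ker_mk'] at hbot
    exact hNZ hbot
  · apply hsup
    rw [← QuotientGroup.ker_mk' Z, ← Subgroup.comap_map_eq, htop, Subgroup.comap_top]

end GroupTheory

section FiniteRankIdeal

variable (R M : Type*) [Ring R] [IsNoetherianRing R] [AddCommGroup M] [Module R M]

/-- The two-sided ideal of endomorphisms of `M` of finite rank, that is, with finitely generated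
range. -/
def finiteRankIdeal : Ideal (Module.End R M) where
  carrier := {φ | φ.range.FG}
  zero_mem' := by
    change (LinearMap.range (0 : Module.End R M)).FG
    rw [LinearMap.range_zero]
    exact Submodule.fg_bot
  add_mem' hφ hψ := (hφ.sup hψ).of_le (LinearMap.range_add_le _ _)
  smul_mem' φ ψ hψ := by
    change (φ ∘ₗ ψ).range.FG
    rw [LinearMap.range_comp]
    exact hψ.map φ

instance : (finiteRankIdeal R M).IsTwoSided :=
  ⟨fun ψ hφ => Submodule.FG.of_le hφ (LinearMap.range_comp_le_range ψ _)⟩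

variable {R M}

theorem fg_range_iff_of_sup_eq_top {N : Type*} [AddCommGroup N] [Module R N] (f : M →ₗ[R] N)
    {U W : Submodule R M} (hW : W.FG) (hUW : U ⊔ W = ⊤) : f.range.FG ↔ (U.map f).FG := by
  refine ⟨fun h => h.of_le LinearMap.map_le_range, fun h => ?_⟩
  rw [LinearMap.range_eq_map, ← hUW, Submodule.map_sup]
  exact h.sup (hW.map f)

variable {G : Type*} [Group G]

/-- The subgroup of elements that a linear action `ρ` of `G` sends to finite-rank perturbations of
the identity, as the kernel of `ρ` modulo `finiteRankIdeal R M`. -/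
def finiteRankKer (ρ : G →* Module.End R M) : Subgroup G :=
  ((Ideal.Quotient.mk (finiteRankIdeal R M)).toMonoidHom.comp ρ).ker

instance (ρ : G →* Module.End R M) : (finiteRankKer ρ).Normal :=
  MonoidHom.normal_ker _

theorem mem_finiteRankKer {ρ : G →* Module.End R M} {g : G} :
    g ∈ finiteRankKer ρ ↔ (ρ g - 1).range.FG :=
  Ideal.Quotient.mk_eq_mk_iff_sub_mem _ _

end FiniteRankIdeal

theorem exists_fg_range_sub_smul_one {R M G : Type*} [CommRing R] [IsNoetherianRing R]
    [AddCommGroup M] [Module R M] [Group G] {ρ : G →* Module.End R M} {Z : Subgroup G}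
    (hZ : ∀ z ∈ Z, ∃ c : R, ρ z = c • 1) {g : G} (hg : g ∈ finiteRankKer ρ ⊔ Z) :
    ∃ c : R, (ρ g - c • 1).range.FG := by
  obtain ⟨n, hn, z, hz, rfl⟩ := Subgroup.mem_sup_of_normal_left.1 hg
  obtain ⟨c, hc⟩ := hZ z hz
  have hfactor : ρ (n * z) - c • 1 = (ρ n - 1) * (c • 1) := by
    rw [map_mul, hc, sub_mul, one_mul]
  refine ⟨c, hfactor ▸ ?_⟩
  exact Ideal.mul_mem_right (c • 1) (finiteRankIdeal R M) (mem_finiteRankKer.1 hn)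

theorem fg_of_forall_notMem_eq_zero {R ι : Type*} [Ring R] [IsNoetherianRing R] {T : Set ι}
    (hT : T.Finite) {W : Submodule R (ι → R)} (hW : ∀ x ∈ W, ∀ i ∉ T, x i = 0) : W.FG := by
  have := hT.to_subtype
  have hinj : Function.Injective (LinearMap.funLeft R R (Subtype.val : T → ι) ∘ₗ W.subtype) := by
    intro x y hxy
    ext i
    by_cases hi : i ∈ T
    · exact congrFun hxy ⟨i, hi⟩
    · rw [hW x x.2 i hi, hW y y.2 i hi]
  exact Module.Finite.iff_fg.1 (Module.Finite.of_injective _ hinj)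

theorem not_fg_of_forall_single_mem {R ι : Type*} [Ring R] [StrongRankCondition R]
    [DecidableEq ι] [Infinite ι] {W : Submodule R (ι → R)} (hW : ∀ n, Pi.single n 1 ∈ W) :
    ¬ W.FG := by
  intro hfg
  have := Module.Finite.iff_fg.2 hfg
  have hindep : LinearIndependent R fun n => (⟨Pi.single n 1, hW n⟩ : W) :=
    LinearIndependent.of_comp W.subtype (Pi.linearIndependent_single_one ι R)
  exact not_finite_iff_infinite.2 ‹_› hindep.finite

section Action

variable {Λ F : Type*} [Field F]

theorem act_one [DecidableEq Λ] (x : Λ → F) : act (1 : Matrix Λ Λ F) x = x := by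
  ext i
  refine (finsum_eq_single _ i fun j hj => ?_).trans ?_
  · rw [Matrix.one_apply_ne hj.symm, zero_mul]
  · rw [Matrix.one_apply_eq, one_mul]

theorem act_single_one [DecidableEq Λ] (a : Matrix Λ Λ F) (j : Λ) :
    act a (Pi.single j 1) = a.col j := by
  ext i
  refine (finsum_eq_single _ j fun k hk => ?_).trans ?_
  · rw [Pi.single_eq_of_ne hk, mul_zero]
  · rw [Pi.single_eq_same, mul_one, Matrix.col_apply]

variable [Preorder Λ]

theorem hasFiniteRank_of_forall_notMem_row_eq_zero {T : Set Λ} (hT : T.Finite)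
    {b : Matrix Λ Λ F} (hb : ∀ i ∉ T, ∀ j, b i j = 0) : HasFiniteRank b := by
  refine Module.Finite.iff_fg.2 (fg_of_forall_notMem_eq_zero hT fun x hx i hi => ?_)
  suffices h : Submodule.span F (act b '' vecL Λ F) ≤ (LinearMap.proj (φ := fun _ => F) i).ker from
    h hx
  rw [Submodule.span_le]
  rintro _ ⟨y, -, rfl⟩
  exact finsum_eq_zero_of_forall_eq_zero fun j => by rw [hb i hi j, zero_mul]

open Classical in
theorem mem_finiteRankAU_iff {g : AU Λ F} :
    g ∈ finiteRankAU Λ F ↔ HasFiniteRank (g.toMatrix - 1) := by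
  refine ⟨?_, fun h => ⟨_, (add_sub_cancel _ _).symm, h⟩⟩
  rintro ⟨b, hb, hrank⟩
  rwa [hb, add_sub_cancel_left]

open Classical in
theorem mem_finiteRankAU_of_forall_notMem_row_eq {T : Set Λ} (hT : T.Finite) {g : AU Λ F}
    (hg : ∀ i ∉ T, ∀ j, g.toMatrix i j = (1 : Matrix Λ Λ F) i j) : g ∈ finiteRankAU Λ F :=
  mem_finiteRankAU_iff.2 <| hasFiniteRank_of_forall_notMem_row_eq_zero hT fun i hi j =>
    sub_eq_zero_of_eq (hg i hi j)

/-- `x` vanishes strictly above `A`, that is, at every `l` strictly above all elements of `A`; for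
`A = ∅` this means `x = 0`. -/
def VanishesAbove (A : Finset Λ) (x : Λ → F) : Prop :=
  ∀ l, (∀ k ∈ A, k < l) → x l = 0

theorem VanishesAbove.mono {A B : Finset Λ} {x : Λ → F} (hx : VanishesAbove A x) (hAB : A ⊆ B) :
    VanishesAbove B x :=
  fun l hl => hx l fun k hk => hl k (hAB hk)

theorem vanishesAbove_single [DecidableEq Λ] (j : Λ) (c : F) : VanishesAbove {j} (Pi.single j c) :=
  fun _ hl => Pi.single_eq_of_ne (M := fun _ => F) (hl j (Finset.mem_singleton_self j)).ne' c

theorem VanishesAbove.act {S : Finset Λ} {a : Matrix Λ Λ F} {x : Λ → F} (ha : Adapted S a)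
    (hx : VanishesAbove S x) : VanishesAbove S (act a x) := by
  refine fun i hi => finsum_eq_zero_of_forall_eq_zero fun j => ?_
  by_contra hne
  rcases ha i j (left_ne_zero_of_mul hne) with hij | ⟨hiS, -⟩
  · exact right_ne_zero_of_mul hne (hx j fun k hk => (hi k hk).trans_le hij)
  · exact (hi i hiS).false

theorem support_mul_subset {S : Finset Λ} (hS : StronglyConvex (S : Set Λ)) {a : Matrix Λ Λ F}
    (ha : Adapted S a) {x : Λ → F} (hx : VanishesAbove S x) {i : Λ} (hi : i ∈ S) :
    (Function.support fun j => a i j * x j) ⊆ S := by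
  intro j hne
  by_contra hj
  have hij : i ≤ j := (ha i j (left_ne_zero_of_mul hne)).resolve_right fun h => hj h.2
  rcases hS j hj with hbelow | habove
  · exact (hbelow i hi).not_ge hij
  · exact right_ne_zero_of_mul hne (hx j habove)

theorem act_apply_eq_sum {S : Finset Λ} (hS : StronglyConvex (S : Set Λ)) {a : Matrix Λ Λ F}
    (ha : Adapted S a) {x : Λ → F} (hx : VanishesAbove S x) {i : Λ} (hi : i ∈ S) :
    act a x i = ∑ j ∈ S, a i j * x j :=
  finsum_eq_sum_of_support_subset _ (support_mul_subset hS ha hx hi)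

variable (Λ F) in
/-- The space of vectors vanishing strictly above some finite set, on which `AU_Λ(F)` acts.
It contains `L(F)`, which is not closed under addition if `Λ` has incomparable maximal elements, and
all unit vectors. -/
def boundedVec : Submodule F (Λ → F) where
  carrier := {x | ∃ A, VanishesAbove A x}
  zero_mem' := ⟨∅, fun _ _ => rfl⟩
  add_mem' := by
    classical
    rintro x y ⟨A, hA⟩ ⟨B, hB⟩
    refine ⟨A ∪ B, fun l hl => ?_⟩
    rw [Pi.add_apply, hA.mono Finset.subset_union_left l hl, hB.mono Finset.subset_union_right l hl,
      add_zero]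
  smul_mem' := by
    rintro c x ⟨A, hA⟩
    exact ⟨A, fun l hl => by rw [Pi.smul_apply, hA l hl, smul_zero]⟩

theorem mem_boundedVec_of_mem_vecL {x : Λ → F} (hx : x ∈ vecL Λ F) : x ∈ boundedVec Λ F :=
  let ⟨k, hk⟩ := hx
  ⟨{k}, fun l hl => hk l (hl k (Finset.mem_singleton_self k)).le⟩

variable (F) in
open Classical in
/-- The unit vector at `j`, as an element of `boundedVec Λ F`. -/
noncomputable def unitVec (j : Λ) : boundedVec Λ F :=
  ⟨Pi.single j 1, {j}, vanishesAbove_single j 1⟩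

variable [ZLike Λ]

theorem exists_adapted₂_vanishesAbove (A : Finset Λ) {a b : Matrix Λ Λ F} (ha : AlmostUpper a)
    (hb : AlmostUpper b) {x : Λ → F} (hx : x ∈ boundedVec Λ F) :
    ∃ S : Finset Λ, A ⊆ S ∧ StronglyConvex (S : Set Λ) ∧ Adapted S a ∧ Adapted S b ∧
      VanishesAbove S x := by
  classical
  obtain ⟨B, hB⟩ := hx
  obtain ⟨S, hABS, hS, haS, hbS⟩ := exists_adapted₂ (A ∪ B) ha hb
  exact ⟨S, Finset.union_subset_left hABS, hS, haS, hbS, hB.mono (Finset.union_subset_right hABS)⟩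

theorem AlmostUpper.act_mem_boundedVec {a : Matrix Λ Λ F} (ha : AlmostUpper a) {x : Λ → F}
    (hx : x ∈ boundedVec Λ F) : act a x ∈ boundedVec Λ F :=
  let ⟨S, _, _, haS, _, hxS⟩ := exists_adapted₂_vanishesAbove ∅ ha ha hx
  ⟨S, hxS.act haS⟩

theorem AlmostUpper.finite_support_mul {a : Matrix Λ Λ F} (ha : AlmostUpper a) {x : Λ → F}
    (hx : x ∈ boundedVec Λ F) (i : Λ) : (Function.support fun j => a i j * x j).Finite :=
  let ⟨S, hiS, hS, haS, _, hxS⟩ := exists_adapted₂_vanishesAbove {i} ha ha hx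
  S.finite_toSet.subset
    (support_mul_subset hS haS hxS (Finset.singleton_subset_iff.1 hiS))

theorem act_sub {a b : Matrix Λ Λ F} (ha : AlmostUpper a) (hb : AlmostUpper b) {x : Λ → F}
    (hx : x ∈ boundedVec Λ F) : act (a - b) x = act a x - act b x := by
  ext i
  simp only [act, Matrix.sub_apply, sub_mul, Pi.sub_apply]
  exact finsum_sub_distrib (ha.finite_support_mul hx i) (hb.finite_support_mul hx i)

theorem act_mulMat {a b : Matrix Λ Λ F} (ha : AlmostUpper a) (hb : AlmostUpper b) {x : Λ → F}
    (hx : x ∈ boundedVec Λ F) : act (mulMat a b) x = act a (act b x) := by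
  ext i
  obtain ⟨S, hiS, hS, haS, hbS, hxS⟩ := exists_adapted₂_vanishesAbove {i} ha hb hx
  have hi : i ∈ S := Finset.singleton_subset_iff.1 hiS
  calc act (mulMat a b) x i = ∑ j ∈ S, mulMat a b i j * x j :=
        act_apply_eq_sum hS (haS.mul hS hbS) hxS hi
    _ = ∑ j ∈ S, ∑ k ∈ S, a i k * (b k j * x j) := Finset.sum_congr rfl fun j hj => by
        simp only [mulMat_apply_eq haS hbS hS.ordConnected subset_rfl hi hj, Finset.sum_mul,
          mul_assoc]
    _ = ∑ k ∈ S, a i k * act b x k := by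
        rw [Finset.sum_comm]
        refine Finset.sum_congr rfl fun k hk => ?_
        rw [act_apply_eq_sum hS hbS hxS hk, Finset.mul_sum]
    _ = act a (act b x) i := (act_apply_eq_sum hS haS (hxS.act hbS) hi).symm

namespace AU

variable (Λ F) in
/-- The linear action of `AU_Λ(F)` on `boundedVec Λ F`. -/
noncomputable def toEnd : AU Λ F →* Module.End F (boundedVec Λ F) where
  toFun g :=
    { toFun x := ⟨act g.toMatrix x, g.almostUpper.act_mem_boundedVec x.2⟩
      map_add' x y := Subtype.ext <| funext fun i => by
        simp only [act, Submodule.coe_add, Pi.add_apply, mul_add]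
        exact finsum_add_distrib (g.almostUpper.finite_support_mul x.2 i)
          (g.almostUpper.finite_support_mul y.2 i)
      map_smul' c x := Subtype.ext <| funext fun i => by
        simp only [act, Submodule.coe_smul, Pi.smul_apply, smul_eq_mul, RingHom.id_apply,
          mul_left_comm _ c, mul_finsum] }
  map_one' := by
    classical exact LinearMap.ext fun x => Subtype.ext (act_one x.1)
  map_mul' g h := LinearMap.ext fun x => Subtype.ext (act_mulMat g.almostUpper h.almostUpper x.2)

open Classical in
theorem coe_toEnd_sub_one_apply (g : AU Λ F) (x : boundedVec Λ F) :
    ((toEnd Λ F g - 1) x : Λ → F) = act (g.toMatrix - 1) x := by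
  rw [← toMatrix_one, act_sub g.almostUpper (1 : AU Λ F).almostUpper x.2, toMatrix_one, act_one]
  rfl

end AU

theorem exists_finset_forall_indicator_mem_vecL [Nonempty Λ] :
    ∃ S : Finset Λ, ∀ x ∈ boundedVec Λ F, (S : Set Λ)ᶜ.indicator x ∈ vecL Λ F := by
  -- If nothing lies strictly above all of `A`, then a strongly convex `S ⊇ A` contains everything
  -- above its elements; otherwise `L(F)` is the whole of `boundedVec Λ F`.
  by_cases h : ∃ A : Finset Λ, ∀ l, ∃ k ∈ A, ¬ k < l
  · obtain ⟨A, hA⟩ := h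
    obtain ⟨S, hAS, hS⟩ := ZLike.exists_finite_stronglyConvex A
    obtain ⟨k, hk, -⟩ := hA (Classical.arbitrary Λ)
    refine ⟨S, fun x _ => ⟨k, fun l hkl => Set.indicator_of_notMem (fun hl => ?_) x⟩⟩
    rcases hS l hl with hbelow | habove
    · exact (hbelow k (hAS hk)).not_ge hkl
    · obtain ⟨m, hm, hml⟩ := hA l
      exact hml (habove m (hAS hm))
  · push Not at h
    refine ⟨∅, fun x ⟨A, hx⟩ => ?_⟩
    obtain ⟨l, hl⟩ := h A
    rw [Finset.coe_empty, Set.compl_empty, Set.indicator_univ]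
    exact ⟨l, fun m hlm => hx m fun k hk => (hl k hk).trans_le hlm⟩

variable (Λ F) in
theorem exists_fg_span_vecL_sup_eq_top [Nonempty Λ] :
    ∃ W : Submodule F (boundedVec Λ F), W.FG ∧
      Submodule.span F (Subtype.val ⁻¹' vecL Λ F) ⊔ W = ⊤ := by
  classical
  obtain ⟨S, hS⟩ := exists_finset_forall_indicator_mem_vecL (Λ := Λ) (F := F)
  refine ⟨Submodule.span F (unitVec F '' S),
    Submodule.fg_span (S.finite_toSet.image _), eq_top_iff.2 fun x _ => ?_⟩
  have hvecL := hS x x.2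
  have hsplit : x = ⟨_, mem_boundedVec_of_mem_vecL hvecL⟩ + ∑ j ∈ S, x.1 j • unitVec F j := by
    ext i
    by_cases hi : i ∈ S <;>
      simp [unitVec, Pi.single_apply, hi]
  rw [hsplit]
  refine Submodule.add_mem_sup (Submodule.subset_span hvecL) (sum_mem fun j hj => ?_)
  exact Submodule.smul_mem _ _ (Submodule.subset_span (Set.mem_image_of_mem _ hj))

namespace AU

open Classical in
theorem hasFiniteRank_sub_one_iff [Nonempty Λ] (g : AU Λ F) :
    HasFiniteRank (g.toMatrix - 1) ↔ (toEnd Λ F g - 1).range.FG := by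
  obtain ⟨W, hW, hsup⟩ := exists_fg_span_vecL_sup_eq_top Λ F
  have himage : act (g.toMatrix - 1) '' vecL Λ F = (boundedVec Λ F).subtype ''
      ((toEnd Λ F g - 1 : Module.End F (boundedVec Λ F)) '' (Subtype.val ⁻¹' vecL Λ F)) := by
    ext y
    constructor
    · rintro ⟨x, hx, rfl⟩
      exact ⟨_, ⟨⟨x, mem_boundedVec_of_mem_vecL hx⟩, hx, rfl⟩, coe_toEnd_sub_one_apply g _⟩
    · rintro ⟨_, ⟨x, hx, rfl⟩, rfl⟩
      exact ⟨x, hx, (coe_toEnd_sub_one_apply g x).symm⟩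
  rw [fg_range_iff_of_sup_eq_top _ hW hsup, HasFiniteRank,
    FiniteDimensional, Module.Finite.iff_fg, himage, Submodule.span_image, Submodule.span_image]
  exact ⟨Submodule.fg_of_fg_map_injective _ Subtype.val_injective, fun h => h.map _⟩

variable (Λ F) in
theorem coe_finiteRankKer_toEnd [Nonempty Λ] :
    (finiteRankKer (toEnd Λ F) : Set (AU Λ F)) = finiteRankAU Λ F := by
  ext g
  rw [mem_finiteRankAU_iff, hasFiniteRank_sub_one_iff]
  exact mem_finiteRankKer

theorem exists_toEnd_eq_smul_one [Nonempty Λ] {z : AU Λ F} (hz : z ∈ scalarSubgroup Λ F) :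
    ∃ c : F, toEnd Λ F z = c • 1 := by
  obtain ⟨hoff, hdiag⟩ := hz
  refine ⟨z.toMatrix (Classical.arbitrary Λ) (Classical.arbitrary Λ), ?_⟩
  ext x i
  refine (finsum_eq_single _ i fun j hj => by rw [hoff i j hj.symm, zero_mul]).trans ?_
  rw [hdiag i (Classical.arbitrary Λ)]
  rfl

end AU

end Action

section Truncation

variable {Λ F : Type*} [Field F]

section Matrix

variable [DecidableEq Λ]

/-- The matrix that agrees with `a` on `T × T` and with the identity matrix elsewhere. -/
def truncate (T : Finset Λ) (a : Matrix Λ Λ F) : Matrix Λ Λ F :=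
  fun i j => if i ∈ T ∧ j ∈ T then a i j else (1 : Matrix Λ Λ F) i j

theorem truncate_apply_of_mem {T : Finset Λ} (a : Matrix Λ Λ F) {i j : Λ} (hi : i ∈ T)
    (hj : j ∈ T) : truncate T a i j = a i j :=
  if_pos ⟨hi, hj⟩

theorem truncate_apply_of_not {T : Finset Λ} (a : Matrix Λ Λ F) {i j : Λ} (h : ¬ (i ∈ T ∧ j ∈ T)) :
    truncate T a i j = (1 : Matrix Λ Λ F) i j :=
  if_neg h

theorem det_res_truncate {T U : Finset Λ} (hTU : T ⊆ U) (a : Matrix Λ Λ F) :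
    (res U (truncate T a)).det = (res T a).det := by
  have hone : (res U (truncate T a)).toSquareBlockProp (fun i => ¬ i.1 ∈ T) = 1 := by
    ext i j
    refine (truncate_apply_of_not a fun h => i.2 h.1).trans ?_
    simp only [Matrix.one_apply, Subtype.ext_iff]
  let e : {i : U // i.1 ∈ T} ≃ T := Equiv.subtypeSubtypeEquivSubtype fun h => hTU h
  have hblock : (res U (truncate T a)).toSquareBlockProp (fun i => i.1 ∈ T) =
      (res T a).submatrix e e := by
    ext i j
    exact truncate_apply_of_mem a i.2 j.2
  rw [Matrix.twoBlockTriangular_det _ fun i : U => i.1 ∈ T, hone, hblock, Matrix.det_one, mul_one,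
    Matrix.det_submatrix_equiv_self]
  intro i hi j hj
  refine (truncate_apply_of_not a fun h => hi h.1).trans (Matrix.one_apply_ne fun h => hi ?_)
  rwa [h]

theorem adapted_truncate [Preorder Λ] (T : Finset Λ) (a : Matrix Λ Λ F) :
    Adapted T (truncate T a) := by
  intro i j hij
  by_cases h : i ∈ T ∧ j ∈ T
  · exact Or.inr h
  · rw [truncate_apply_of_not a h] at hij
    exact Or.inl (not_imp_comm.1 Matrix.one_apply_ne hij).le

end Matrix

variable [Preorder Λ]

open Classical in
theorem nonsingular_truncate {T : Finset Λ} (hT : (T : Set Λ).OrdConnected) {a : Matrix Λ Λ F}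
    (ha : IsUnit (res T a)) : Nonsingular (truncate T a) := by
  refine ⟨T, hT, fun U _ hTU => ?_⟩
  rwa [Matrix.isUnit_iff_isUnit_det, det_res_truncate hTU, ← Matrix.isUnit_iff_isUnit_det]

open Classical in
/-- The finite-rank perturbation `truncate T g` of the identity, as an element of `AU_Λ(F)`. -/
noncomputable def AU.truncate (g : AU Λ F) {T : Finset Λ} (hT : (T : Set Λ).OrdConnected)
    (hgT : IsUnit (res T g.toMatrix)) : AU Λ F where
  toMatrix := AlmostUpperTriangular.truncate T g.toMatrix
  almostUpper := (adapted_truncate T _).almostUpper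
  nonsingular := nonsingular_truncate hT hgT

open Classical in
theorem AU.truncate_mem_finiteRankAU (g : AU Λ F) {T : Finset Λ} (hT : (T : Set Λ).OrdConnected)
    (hgT : IsUnit (res T g.toMatrix)) : g.truncate hT hgT ∈ finiteRankAU Λ F :=
  mem_finiteRankAU_of_forall_notMem_row_eq T.finite_toSet fun _ hi _ =>
    truncate_apply_of_not _ fun h => hi h.1

open Classical in
theorem AU.truncate_mem_UJoin {S : Finset Λ} {g : AU Λ F} (hgS : g ∈ UJoin Λ F S) {T : Finset Λ}
    (hT : (T : Set Λ).OrdConnected) (hgT : IsUnit (res T g.toMatrix)) :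
    g.truncate hT hgT ∈ UJoin Λ F S := by
  intro i j hij
  by_cases h : i ∈ T ∧ j ∈ T
  · exact (truncate_apply_of_mem _ h.1 h.2).trans (hgS i j hij)
  · refine (truncate_apply_of_not _ h).trans (Matrix.one_apply_ne fun heq => hij ?_)
    rw [heq]
    exact Relation.ReflTransGen.refl

theorem Adapted.mem_UJoin {S : Finset Λ} {g : AU Λ F} (hg : Adapted S g.toMatrix) :
    g ∈ UJoin Λ F S :=
  fun i j hij => not_imp_comm.1 (hg i j) fun h => hij (Relation.ReflTransGen.single h)

theorem exists_finset_forall_mem_of_isOpen {V : Set (AU Λ F)} (hV : IsOpen V) {S : Finset Λ}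
    (hS : (S : Set Λ).OrdConnected) {g : AU Λ F} (hgV : g ∈ V) (hgS : g ∈ UJoin Λ F S) :
    ∃ T : Finset Λ, ∀ h ∈ UJoin Λ F S,
      (∀ i ∈ T, ∀ j ∈ T, h.toMatrix i j = g.toMatrix i j) → h ∈ V := by
  classical
  let _ : TopologicalSpace F := ⊥
  obtain ⟨W, hW, hWV⟩ := isOpen_induced_iff.1 <|
    isOpen_coinduced.1 (isOpen_iSup_iff.1 hV ⟨S, hS⟩)
  have hmem : ∀ h ∈ UJoin Λ F S, (fun p : Λ × Λ => h.toMatrix p.1 p.2) ∈ W ↔ h ∈ V :=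
    fun h hh => Set.ext_iff.1 hWV ⟨h, hh⟩
  obtain ⟨E, u, hu, hEW⟩ := isOpen_pi_iff.1 hW _ ((hmem g hgS).2 hgV)
  refine ⟨E.image Prod.fst ∪ E.image Prod.snd, fun h hhS heq => (hmem h hhS).1 (hEW ?_)⟩
  intro p hp
  change h.toMatrix p.1 p.2 ∈ u p
  rw [heq p.1 (Finset.mem_union_left _ (Finset.mem_image_of_mem _ hp)) p.2
    (Finset.mem_union_right _ (Finset.mem_image_of_mem _ hp))]
  exact (hu p hp).2

variable (Λ F) in
theorem dense_finiteRankAU [ZLike Λ] : Dense (finiteRankAU Λ F) := by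
  classical
  refine dense_iff_inter_open.2 fun V hV ⟨g, hgV⟩ => ?_
  obtain ⟨A, -, hA⟩ := g.nonsingular
  obtain ⟨S, hAS, hS, hgS⟩ := exists_adapted A g.almostUpper
  obtain ⟨E, hE⟩ := exists_finset_forall_mem_of_isOpen hV hS.ordConnected hgV hgS.mem_UJoin
  obtain ⟨T, hSET, hT⟩ := ZLike.exists_finite_stronglyConvex (S ∪ E)
  obtain ⟨hST, hET⟩ := Finset.union_subset_iff.1 hSET
  have hgT : IsUnit (res T g.toMatrix) := hA T hT.ordConnected (hAS.trans hST)
  refine ⟨g.truncate hT.ordConnected hgT, hE _ ?_ fun i hi j hj => ?_,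
    g.truncate_mem_finiteRankAU _ _⟩
  · exact AU.truncate_mem_UJoin hgS.mem_UJoin _ _
  · exact truncate_apply_of_mem _ (hET hi) (hET hj)

end Truncation

section Matching

variable {Λ F ι : Type*} [Field F]

open Classical in
variable (F) in
/-- The matrix with entry `1` at the positions `(r n, s n)` and `0` elsewhere. -/
noncomputable def matchingMatrix (r s : ι → Λ) : Matrix Λ Λ F :=
  fun i j => if ∃ n, r n = i ∧ s n = j then 1 else 0

theorem exists_of_matchingMatrix_ne_zero {r s : ι → Λ} {i j : Λ}
    (h : matchingMatrix F r s i j ≠ 0) : ∃ n, r n = i ∧ s n = j :=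
  not_imp_comm.1 (fun h => if_neg h) h

theorem matchingMatrix_apply_self (r s : ι → Λ) (n : ι) : matchingMatrix F r s (r n) (s n) = 1 :=
  if_pos ⟨n, rfl, rfl⟩

theorem submatrix_matchingMatrix [DecidableEq ι] {r s : ι → Λ} (hr : Function.Injective r)
    (hs : Function.Injective s) : (matchingMatrix F r s).submatrix r s = 1 := by
  ext m n
  by_cases hmn : m = n
  · rw [hmn, Matrix.one_apply_eq]
    exact matchingMatrix_apply_self r s n
  · rw [Matrix.one_apply_ne hmn]
    refine if_neg fun ⟨k, hkm, hkn⟩ => hmn ?_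
    rw [← hr hkm, hs hkn]

theorem res_matchingMatrix_mul_self {r s : ι → Λ} (hrs : ∀ m n, r m ≠ s n) (T : Finset Λ) :
    res T (matchingMatrix F r s) * res T (matchingMatrix F r s) = 0 := by
  ext i j
  refine Finset.sum_eq_zero fun k _ => ?_
  by_contra hne
  obtain ⟨n, -, hn⟩ := exists_of_matchingMatrix_ne_zero (left_ne_zero_of_mul hne)
  obtain ⟨m, hm, -⟩ := exists_of_matchingMatrix_ne_zero (right_ne_zero_of_mul hne)
  exact hrs m n (hm.trans hn.symm)

variable [Preorder Λ]

namespace AU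

open Classical in
variable (F) in
/-- The upper triangular matrix with diagonal entries `1` and further entries `1` at the positions
`(r n, s n)`. -/
noncomputable def oneAddMatching (r s : ι → Λ) (hle : ∀ n, r n ≤ s n) (hrs : ∀ m n, r m ≠ s n) :
    AU Λ F where
  toMatrix := 1 + matchingMatrix F r s
  almostUpper := by
    refine Adapted.almostUpper (S := ∅) fun i j hij => Or.inl ?_
    by_cases h : i = j
    · exact h.le
    · rw [Matrix.add_apply, Matrix.one_apply_ne h, zero_add] at hij
      obtain ⟨n, rfl, rfl⟩ := exists_of_matchingMatrix_ne_zero hij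
      exact hle n
  nonsingular := by
    refine ⟨∅, by simpa only [Finset.coe_empty] using Set.ordConnected_empty, fun T _ _ => ?_⟩
    have hnil : IsNilpotent (res T (matchingMatrix F r s)) :=
      ⟨2, by rw [pow_two, res_matchingMatrix_mul_self hrs]⟩
    change IsUnit (res T 1 + res T (matchingMatrix F r s))
    rw [res_one]
    exact hnil.isUnit_one_add

theorem oneAddMatching_apply_of_ne {r s : ι → Λ} (hle : ∀ n, r n ≤ s n) (hrs : ∀ m n, r m ≠ s n)
    {i j : Λ} (hij : i ≠ j) :
    (oneAddMatching F r s hle hrs).toMatrix i j = matchingMatrix F r s i j := by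
  classical
  exact (congrArg (· + matchingMatrix F r s i j) (Matrix.one_apply_ne hij)).trans (zero_add _)

theorem oneAddMatching_mem_finiteRankAU [Finite ι] {r s : ι → Λ} (hle : ∀ n, r n ≤ s n)
    (hrs : ∀ m n, r m ≠ s n) : oneAddMatching F r s hle hrs ∈ finiteRankAU Λ F := by
  classical
  refine mem_finiteRankAU_of_forall_notMem_row_eq (Set.finite_range r) fun i hi j => ?_
  refine (congrArg (_ + ·) ?_).trans (add_zero _)
  refine not_imp_comm.1 exists_of_matchingMatrix_ne_zero fun ⟨n, hn, _⟩ => hi ⟨n, hn⟩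

variable [ZLike Λ]

theorem oneAddMatching_notMem_scalarSubgroup [Nonempty ι] {r s : ι → Λ} (hle : ∀ n, r n ≤ s n)
    (hrs : ∀ m n, r m ≠ s n) : oneAddMatching F r s hle hrs ∉ scalarSubgroup Λ F := by
  intro hscalar
  let n := Classical.arbitrary ι
  have hzero := hscalar.1 (r n) (s n) (hrs n n)
  rw [oneAddMatching_apply_of_ne hle hrs (hrs n n), matchingMatrix_apply_self] at hzero
  exact one_ne_zero hzero

theorem not_fg_range_toEnd_sub_smul_one [DecidableEq ι] [Infinite ι] {r s : ι → Λ}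
    (hrs : ∀ m n, r m ≠ s n) {g : AU Λ F} (hg : g.toMatrix.submatrix r s = 1) (c : F) :
    ¬ (toEnd Λ F g - c • 1).range.FG := by
  classical
  intro hfg
  refine not_fg_of_forall_single_mem (fun n => ?_)
    (hfg.map (LinearMap.funLeft F F r ∘ₗ (boundedVec Λ F).subtype))
  refine ⟨_, LinearMap.mem_range_self _ (unitVec F (s n)), funext fun m => ?_⟩
  have hsingle : (Pi.single (s n) 1 : Λ → F) (r m) = 0 := Pi.single_eq_of_ne (hrs m n) 1
  calc act g.toMatrix (Pi.single (s n) 1) (r m) - c • (Pi.single (s n) 1 : Λ → F) (r m)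
      = g.toMatrix (r m) (s n) := by
        rw [hsingle, smul_zero, sub_zero, act_single_one, Matrix.col_apply]
    _ = (1 : Matrix ι ι F) m n := congrFun₂ hg m n
    _ = (Pi.single n 1 : ι → F) m := by rw [Matrix.one_apply, Pi.single_apply]

end AU

end Matching

section Infinite

variable {Λ : Type*} [Preorder Λ] [ZLike Λ] [Infinite Λ]

theorem exists_lt_notMem (A : Finset Λ) : ∃ i j : Λ, i < j ∧ i ∉ A ∧ j ∉ A := by
  classical
  obtain ⟨i, hi⟩ := Infinite.exists_notMem_finset A
  obtain ⟨S, hAS, hS⟩ := ZLike.exists_finite_stronglyConvex (insert i A)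
  obtain ⟨hiS, hAS⟩ := Finset.insert_subset_iff.1 hAS
  obtain ⟨j, hj⟩ := Infinite.exists_notMem_finset S
  have hjA : j ∉ A := fun h => hj (hAS h)
  rcases hS j hj with hbelow | habove
  · exact ⟨j, i, hbelow i hiS, hjA, hi⟩
  · exact ⟨i, j, habove i hiS, hi, hjA⟩

variable (Λ) in
theorem exists_seq_disjoint_lt : ∃ r s : ℕ → Λ, (∀ n, r n < s n) ∧ Function.Injective r ∧
    Function.Injective s ∧ ∀ m n, r m ≠ s n := by
  classical
  let rel : Λ × Λ → Λ × Λ → Prop := fun p q =>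
    p.1 ≠ q.1 ∧ p.1 ≠ q.2 ∧ p.2 ≠ q.1 ∧ p.2 ≠ q.2
  have hsymm : Std.Symm rel := ⟨fun p q h => ⟨h.1.symm, h.2.2.1.symm, h.2.1.symm, h.2.2.2.symm⟩⟩
  obtain ⟨f, hlt, hf⟩ := exists_seq_of_forall_finset_exists' (fun p : Λ × Λ => p.1 < p.2) rel
    fun E _ => by
      obtain ⟨i, j, hij, hi, hj⟩ := exists_lt_notMem (E.image Prod.fst ∪ E.image Prod.snd)
      simp only [Finset.mem_union, Finset.mem_image, not_or, not_exists, not_and] at hi hj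
      exact ⟨(i, j), hij, fun p hp => ⟨hi.1 p hp, hj.1 p hp, hi.2 p hp, hj.2 p hp⟩⟩
  refine ⟨fun n => (f n).1, fun n => (f n).2, hlt,
    Function.injective_iff_pairwise_ne.2 fun m n hmn => (hf hmn).1,
    Function.injective_iff_pairwise_ne.2 fun m n hmn => (hf hmn).2.2.2, fun m n => ?_⟩
  obtain rfl | hmn := eq_or_ne m n
  · exact (hlt m).ne
  · exact (hf hmn).2.1

variable (Λ) (F : Type*) [Field F]

theorem finiteRankKer_toEnd_sup_scalarSubgroup_ne_top :
    finiteRankKer (AU.toEnd Λ F) ⊔ scalarSubgroup Λ F ≠ ⊤ := by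
  intro htop
  obtain ⟨r, s, hlt, hr, hs, hrs⟩ := exists_seq_disjoint_lt Λ
  have hle : ∀ n, r n ≤ s n := fun n => (hlt n).le
  have hone : (AU.oneAddMatching F r s hle hrs).toMatrix.submatrix r s = 1 := by
    rw [← submatrix_matchingMatrix hr hs]
    ext m n
    exact AU.oneAddMatching_apply_of_ne hle hrs (hrs m n)
  obtain ⟨c, hc⟩ := exists_fg_range_sub_smul_one (fun z => AU.exists_toEnd_eq_smul_one)
    (htop ▸ Subgroup.mem_top (AU.oneAddMatching F r s hle hrs))
  exact AU.not_fg_range_toEnd_sub_smul_one hrs hone c hc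

theorem not_finiteRankKer_toEnd_le_scalarSubgroup :
    ¬ finiteRankKer (AU.toEnd Λ F) ≤ scalarSubgroup Λ F := by
  intro hle
  obtain ⟨i, j, hij, -, -⟩ := exists_lt_notMem (∅ : Finset Λ)
  have hmem := AU.oneAddMatching_mem_finiteRankAU (F := F) (ι := Unit) (r := fun _ => i)
    (s := fun _ => j) (fun _ => hij.le) fun _ _ => hij.ne
  rw [← AU.coe_finiteRankKer_toEnd] at hmem
  exact AU.oneAddMatching_notMem_scalarSubgroup _ _ (hle hmem)

end Infinite

end AlmostUpperTriangular

open AlmostUpperTriangular in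
theorem mainTheorem5 (Λ : Type*) [Preorder Λ] [AlmostUpperTriangular.ZLike Λ] [Infinite Λ]
    (F : Type*) [Field F] :
    (∃ N : Subgroup (AlmostUpperTriangular.AU Λ F),
      (N : Set (AlmostUpperTriangular.AU Λ F)) = AlmostUpperTriangular.finiteRankAU Λ F ∧
      N ≠ ⊤ ∧ Dense (N : Set (AlmostUpperTriangular.AU Λ F)) ∧ N.Normal) ∧
    Nontrivial (AlmostUpperTriangular.AU Λ F ⧸ AlmostUpperTriangular.scalarSubgroup Λ F) ∧
    ¬ IsSimpleGroup
      (AlmostUpperTriangular.AU Λ F ⧸ AlmostUpperTriangular.scalarSubgroup Λ F) := by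
  have hsup := finiteRankKer_toEnd_sup_scalarSubgroup_ne_top Λ F
  have hle := not_finiteRankKer_toEnd_le_scalarSubgroup Λ F
  refine ⟨⟨finiteRankKer (AU.toEnd Λ F), AU.coe_finiteRankKer_toEnd Λ F, fun htop => ?_, ?_,
    inferInstance⟩, QuotientGroup.nontrivial_iff.2 fun htop => ?_,
    not_isSimpleGroup_quotient_of_sup_ne_top hle hsup⟩
  · exact hsup (by rw [htop, top_sup_eq])
  · rw [AU.coe_finiteRankKer_toEnd]
    exact dense_finiteRankAU Λ F
  · exact hle (by rw [htop]; exact le_top)
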